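/- Let $R$ be an associative ring with identity (not necessarily commutative). Write $J(R)$ for its Jacobson radical and $[a,b]=ab-ba$ for $a,b\in R$. An element $a\in R$ is called optimally J-clean if there exists an idempotent $e\in R$ such that $a-e\in J(R)$, $ae=ea$, and for every $b\in R$ there exists $c\in R$ with $[a,c]=[e,b]$. Let $R[[x]]$ be the ring of formal power series over $R$ in an indeterminate $x$ that commutes with the elements of $R$, and let $f(x)\in R[[x]]$. Then the following are equivalent: 1. $f(0)\in R$ is optimally J-clean in $R$. 2. $f(x)\in R[[x]]$ is optimally J-clean in $R[[x]]$. -/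

import Mathlib

/-- An element `a` of an associative unital (not necessarily commutative) ring `R` is
*optimally J-clean* if there is an idempotent `e` with `a - e` in the Jacobson radical of `R`
and `a * e = e * a`, such that for every `b` there is `c` with `[a, c] = [e, b]`, where
`[x, y] = x * y - y * x`. -/
def IsOptimallyJClean {R : Type*} [Ring R] (a : R) : Prop :=
  ∃ e : R, IsIdempotentElem e ∧ a - e ∈ Ring.jacobson R ∧ a * e = e * a ∧
    ∀ b : R, ∃ c : R, a * c - c * a = e * b - b * e

/-! Passing to the constant term is a surjective ring map, which gives one direction. Conversely,
write f = a + Xh with witness e for a. Solvability of [a, c] = [e, b] lets a unit 1 + Xv conjugate f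
to a + Xk with k commuting with e; then e is a witness for a + Xk. Both v and the new commutator
solutions come from X-adic fixed points (`exists_fixedPoint`). -/

/-- Being optimally J-clean passes to images under surjective ring homomorphisms. -/
theorem IsOptimallyJClean.map {R S : Type*} [Ring R] [Ring S] (φ : R →+* S)
    (hφ : Function.Surjective φ) {a : R} (h : IsOptimallyJClean a) : IsOptimallyJClean (φ a) := by
  obtain ⟨e, he, hJ, hae, hs⟩ := h
  have : RingHomSurjective φ := ⟨hφ⟩
  refine ⟨φ e, he.map φ, ?_, ?_, fun b => ?_⟩
  · rw [← map_sub]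
    exact Ring.le_comap_jacobson φ hJ
  · rw [← map_mul, hae, map_mul]
  · obtain ⟨b, rfl⟩ := hφ b
    obtain ⟨c, hc⟩ := hs b
    exact ⟨φ c, by simp only [← map_mul, ← map_sub, hc]⟩

/-- Being optimally J-clean is invariant under conjugation. -/
theorem IsOptimallyJClean.of_mul_eq_mul {R : Type*} [Ring R] {f g u : R} (hu : IsUnit u)
    (h : u * f = g * u) (hg : IsOptimallyJClean g) : IsOptimallyJClean f := by
  obtain ⟨u, rfl⟩ := hu
  have := hg.map (MulSemiringAction.toRingHom (ConjAct Rˣ) R (ConjAct.toConjAct u⁻¹))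
    (MulAction.surjective _)
  simpa [ConjAct.units_smul_def, mul_assoc, ← h] using this

/-- If `e` is an idempotent commuting with `a` and `[e, b] ∈ [a, R]` for all `b`, the solution `c` of
`[a, c] = [e, b]` can be taken off-diagonal with respect to `e`. -/
theorem exists_offDiagonal_commutator_eq {R : Type*} [Ring R] {a e : R} (he : IsIdempotentElem e)
    (hae : a * e = e * a) (hs : ∀ b : R, ∃ c : R, a * c - c * a = e * b - b * e) (b : R) :
    ∃ c : R, a * c - c * a = e * b - b * e ∧ ⁅e, ⁅e, c⁆⁆ = c := by
  obtain ⟨c, hc⟩ := hs b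
  have hee : e * e = e := he
  have he' (x : R) : e * (e * x) = e * x := by rw [← mul_assoc, hee]
  have ha' (x : R) : a * (e * x) = e * (a * x) := by rw [← mul_assoc, hae, mul_assoc]
  -- Since e is idempotent, c ↦ [e, [e, c]] projects onto the off-diagonal part ec(1 - e) + (1 -
  -- e)ce. It commutes with [a, ·] and fixes [e, b].
  refine ⟨⁅e, ⁅e, c⁆⁆, ?_, ?_⟩
  · trans ⁅e, ⁅e, a * c - c * a⁆⁆
    · simp only [Ring.lie_def, mul_sub, sub_mul, mul_assoc, hee, he', ha', hae]
      abel
    · rw [hc]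
      simp only [Ring.lie_def, mul_sub, sub_mul, mul_assoc, hee, he']
      abel
  · simp only [Ring.lie_def, mul_sub, sub_mul, mul_assoc, hee, he']
    abel

namespace PowerSeries

variable {R : Type*}

/-- Two power series agree in all degrees below `n`. -/
def AgreeBelow [Semiring R] (n : ℕ) (φ ψ : PowerSeries R) : Prop :=
  ∀ m < n, coeff m φ = coeff m ψ

section Ring

variable [Ring R] {n : ℕ} {φ φ' ψ ψ' : PowerSeries R}

theorem AgreeBelow.refl (φ : PowerSeries R) : AgreeBelow n φ φ := fun _ _ => rfl

theorem AgreeBelow.sub (h : AgreeBelow n φ φ') (h' : AgreeBelow n ψ ψ') :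
    AgreeBelow n (φ - ψ) (φ' - ψ') := fun m hm => by
  rw [map_sub, map_sub, h m hm, h' m hm]

theorem AgreeBelow.add (h : AgreeBelow n φ φ') (h' : AgreeBelow n ψ ψ') :
    AgreeBelow n (φ + ψ) (φ' + ψ') := fun m hm => by
  rw [map_add, map_add, h m hm, h' m hm]

theorem AgreeBelow.mul (h : AgreeBelow n φ φ') (h' : AgreeBelow n ψ ψ') :
    AgreeBelow n (φ * ψ) (φ' * ψ') := fun m hm => by
  rw [coeff_mul, coeff_mul]
  refine Finset.sum_congr rfl fun p hp => ?_
  have := Finset.HasAntidiagonal.mem_antidiagonal.mp hp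
  rw [h p.1 (by omega), h' p.2 (by omega)]

theorem AgreeBelow.lie (h : AgreeBelow n φ φ') (h' : AgreeBelow n ψ ψ') :
    AgreeBelow n ⁅φ, ψ⁆ ⁅φ', ψ'⁆ :=
  (h.mul h').sub (h'.mul h)

theorem AgreeBelow.X_mul (h : AgreeBelow n φ φ') : AgreeBelow (n + 1) (X * φ) (X * φ') := by
  rintro (_ | m) hm
  · simp
  · rw [coeff_succ_X_mul, coeff_succ_X_mul, h m (by omega)]

/-- A self-map of the power series ring that is contracting for the `X`-adic topology has a fixed
point. -/
theorem exists_fixedPoint (F : PowerSeries R → PowerSeries R)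
    (hF : ∀ n φ ψ, AgreeBelow n φ ψ → AgreeBelow (n + 1) (F φ) (F ψ)) : ∃ φ, F φ = φ := by
  have hit (n k : ℕ) : AgreeBelow n (F^[n] 0) (F^[n + k] 0) := by
    induction n with
    | zero => exact fun m hm => absurd hm (Nat.not_lt_zero m)
    | succ n ih =>
      rw [Nat.succ_add, Function.iterate_succ_apply', Function.iterate_succ_apply']
      exact hF _ _ _ ih
  -- The coefficient of degree n is constant from the iterate n + 1 on.
  let φ : PowerSeries R := mk fun n => coeff n (F^[n + 1] 0)
  have hφ (n : ℕ) : AgreeBelow n (F^[n] 0) φ := fun m hm => by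
    obtain ⟨k, rfl⟩ := Nat.exists_eq_add_of_le (Nat.succ_le_of_lt hm)
    rw [coeff_mk]
    exact (hit (m + 1) k m m.lt_succ_self).symm
  refine ⟨φ, PowerSeries.ext fun n => ?_⟩
  rw [← hφ (n + 1) n n.lt_succ_self, Function.iterate_succ_apply']
  exact (hF _ _ _ (hφ n) n n.lt_succ_self).symm

/-- A power series lies in the Jacobson radical if its constant coefficient does. -/
theorem mem_jacobson_of_constantCoeff (h : constantCoeff φ ∈ Ring.jacobson R) :
    φ ∈ Ring.jacobson (PowerSeries R) := by
  rw [← Ideal.jacobson_bot, Ideal.mem_jacobson_iff] at h ⊢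
  intro y
  obtain ⟨z, hz⟩ := h (constantCoeff y)
  rw [Ideal.mem_bot, sub_eq_zero] at hz
  have hu : IsUnit (C z * y * φ + C z) := by
    rw [isUnit_iff_constantCoeff]
    simp [hz]
  obtain ⟨w, hw⟩ := hu.exists_left_inv
  refine ⟨w * C z, ?_⟩
  rw [Ideal.mem_bot, sub_eq_zero, ← hw]
  simp only [mul_add, mul_assoc]

/-- Lifting an off-diagonal solution operator for `[a, c] = [e, b]` coefficientwise. -/
theorem exists_coeffwise_solution {a e : R} (he : IsIdempotentElem e) (hae : a * e = e * a)
    (hs : ∀ b : R, ∃ c : R, a * c - c * a = e * b - b * e) :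
    ∃ S : PowerSeries R → PowerSeries R, (∀ b, ⁅C a, S b⁆ = ⁅C e, b⁆) ∧
      (∀ b, ⁅C e, ⁅C e, S b⁆⁆ = S b) ∧
      ∀ n b b', AgreeBelow n b b' → AgreeBelow n (S b) (S b') := by
  choose s hs hs' using exists_offDiagonal_commutator_eq he hae hs
  have hC (x : R) (φ : PowerSeries R) (n : ℕ) : coeff n ⁅C x, φ⁆ = ⁅x, coeff n φ⁆ := by
    simp [Ring.lie_def, coeff_C_mul, coeff_mul_C]
  refine ⟨fun b => mk fun n => s (coeff n b), fun b => ?_, fun b => ?_, fun n b b' h m hm => ?_⟩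
  · ext n
    rw [hC, hC, coeff_mk]
    exact hs _
  · ext n
    rw [hC, hC, coeff_mk, hs']
  · rw [coeff_mk, coeff_mk, h m hm]

/-- If `k` commutes with `e`, then `a + X k` inherits optimal J-cleanness from `a`. -/
theorem isOptimallyJClean_C_add_X_mul {a e : R} (he : IsIdempotentElem e)
    (hJ : a - e ∈ Ring.jacobson R) (hae : a * e = e * a)
    (hs : ∀ b : R, ∃ c : R, a * c - c * a = e * b - b * e) {k : PowerSeries R}
    (hk : Commute (C e) k) : IsOptimallyJClean (C a + X * k) := by
  obtain ⟨S, hS, hS', hSn⟩ := exists_coeffwise_solution he hae hs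
  have hee : C e * C e = C e := he.map C
  refine ⟨C e, hee, mem_jacobson_of_constantCoeff (by simpa using hJ), ?_, fun b => ?_⟩
  · rw [add_mul, mul_add, ← map_mul, hae, map_mul, mul_assoc, ← hk.eq, ← mul_assoc, ← mul_assoc,
      (commute_X (C e)).eq]
  -- The fixed point satisfies [a, c] = [e, b] - X[e, [e, [k, c]]]. As c is off-diagonal and k
  -- commutes with e, the double bracket is just [k, c], so [a + Xk, c] = [e, b].
  obtain ⟨c, hc⟩ := exists_fixedPoint (fun c => S (b - X * ⁅C e, ⁅k, c⁆⁆)) fun n φ ψ h =>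
    hSn _ _ _ ((AgreeBelow.refl b).sub
      ((AgreeBelow.refl (C e)).lie ((AgreeBelow.refl k).lie h)).X_mul)
  have hc' : ⁅C e, ⁅C e, c⁆⁆ = c := by rw [← hc, hS']
  have h1 : ⁅C a, c⁆ = ⁅C e, b⁆ - ⁅C e, X * ⁅C e, ⁅k, c⁆⁆⁆ := by
    have := hS (b - X * ⁅C e, ⁅k, c⁆⁆)
    rw [hc] at this
    rw [this]
    simp only [Ring.lie_def, mul_sub, sub_mul]
    abel
  have hX (x : PowerSeries R) : ⁅C e, X * x⁆ = X * ⁅C e, x⁆ := by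
    rw [Ring.lie_def, Ring.lie_def, mul_sub, ← mul_assoc, (commute_X (C e)).eq, mul_assoc,
      mul_assoc]
  have hek (x : PowerSeries R) : ⁅C e, ⁅k, x⁆⁆ = ⁅k, ⁅C e, x⁆⁆ := by
    have hk' (y : PowerSeries R) : C e * (k * y) = k * (C e * y) := by
      rw [← mul_assoc, hk.eq, mul_assoc]
    simp only [Ring.lie_def, mul_sub, sub_mul, mul_assoc, hk', hk.eq]
    abel
  have h2 : ⁅C e, ⁅C e, ⁅k, c⁆⁆⁆ = ⁅k, c⁆ := by rw [hek, hek, hc']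
  rw [hX, h2, eq_sub_iff_add_eq] at h1
  refine ⟨c, ?_⟩
  rw [← Ring.lie_def (C e), ← h1]
  have hXc : c * (X * k) = X * (c * k) := by rw [← mul_assoc, (commute_X c).eq, mul_assoc]
  simp only [Ring.lie_def, add_mul, mul_add, mul_sub, mul_assoc, hXc]
  abel

/-- Over an optimally J-clean constant coefficient, every power series is conjugate to one whose
higher part commutes with the idempotent. -/
theorem exists_conjugate_commute {a e : R} (he : IsIdempotentElem e) (hae : a * e = e * a)
    (hs : ∀ b : R, ∃ c : R, a * c - c * a = e * b - b * e) (h : PowerSeries R) :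
    ∃ v k : PowerSeries R, Commute (C e) k ∧
      (1 + X * v) * (C a + X * h) = (C a + X * k) * (1 + X * v) := by
  obtain ⟨S, hS, -, hSn⟩ := exists_coeffwise_solution he hae hs
  have hee : C e * C e = C e := he.map C
  have hee' (x : PowerSeries R) : C e * (C e * x) = C e * x := by rw [← mul_assoc, hee]
  let v (K : PowerSeries R) := S ⁅C e, K⁆
  let k (K : PowerSeries R) := K - ⁅C e, ⁅C e, K⁆⁆
  -- Cancelling X, the conjugation equation reads k + [a, v] = h + X(vh - kv). Let K be the common
  -- value: k is its diagonal part, and v solves [a, v] = [e, [e, K]], its off-diagonal part.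
  obtain ⟨K, hK⟩ := exists_fixedPoint (fun K => h + X * (v K * h - k K * v K)) fun n φ ψ hφ => by
    have he := (AgreeBelow.refl (C e)).lie hφ
    have hv : AgreeBelow n (v φ) (v ψ) := hSn _ _ _ he
    have hk : AgreeBelow n (k φ) (k ψ) := hφ.sub ((AgreeBelow.refl (C e)).lie he)
    exact (AgreeBelow.refl h).add ((hv.mul (AgreeBelow.refl h)).sub (hk.mul hv)).X_mul
  refine ⟨v K, k K, ?_, ?_⟩
  · simp only [k, commute_iff_eq, Ring.lie_def, mul_sub, sub_mul, mul_assoc, hee, hee']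
    abel
  have h1 : k K + (C a * v K - v K * C a) = h + X * (v K * h - k K * v K) := by
    rw [hK, ← Ring.lie_def, hS]
    exact sub_add_cancel _ _
  have h2 : C a * v K - v K * C a = h + X * (v K * h - k K * v K) - k K :=
    eq_sub_of_add_eq' h1
  rw [sub_eq_iff_eq_add] at h2
  have hX (x y : PowerSeries R) : x * (X * y) = X * (x * y) := by
    rw [← mul_assoc, (commute_X x).eq, mul_assoc]
  simp only [mul_add, add_mul, mul_one, one_mul, mul_assoc, hX, h2, mul_sub]
  abel

end Ring

end PowerSeries

theorem mainTheorem12 {R : Type*} [Ring R] (f : PowerSeries R) :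
    IsOptimallyJClean (PowerSeries.constantCoeff f) ↔ IsOptimallyJClean f := by
  refine ⟨fun ⟨e, he, hJ, hae, hs⟩ => ?_, fun h => h.map _ fun r => ⟨PowerSeries.C r, by simp⟩⟩
  obtain ⟨v, k, hk, hvk⟩ := PowerSeries.exists_conjugate_commute he hae hs
    (PowerSeries.mk fun n => PowerSeries.coeff (n + 1) f)
  rw [add_comm (PowerSeries.C _) (PowerSeries.X * PowerSeries.mk _),
    ← PowerSeries.eq_X_mul_shift_add_const] at hvk
  refine IsOptimallyJClean.of_mul_eq_mul ?_ hvk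
    (PowerSeries.isOptimallyJClean_C_add_X_mul he hJ hae hs hk)
  rw [PowerSeries.isUnit_iff_constantCoeff]
  simp
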